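/- Let $\Omega\subseteq\mathbb{C}^n$ be a domain (non-empty, open, connected), let $\mathcal{E}$ be a complex Hilbert space, and let $\mathcal{H}_{k_1},\mathcal{H}_{k_2}$ be reproducing kernel Hilbert spaces of holomorphic functions on $\Omega$ with scalar kernels $k_1,k_2$. Let $\mathcal{H}_{k_1k_2}$ be the reproducing kernel Hilbert space with kernel $k_1k_2$. For $k\in\{k_1,k_1k_2\}$ identify the Hilbert space tensor product $\mathcal{H}_k\otimes\mathcal{E}$ with the reproducing kernel Hilbert space of $\mathcal{E}$-valued functions on $\Omega$ with kernel $k\,I_{\mathcal{E}}$, the tensor $f\otimes\eta$ being the function $z\mapsto f(z)\eta$. For a reproducing kernel Hilbert space $\mathcal{H}$ of $\mathcal{E}$-valued functions on $\Omega$, a multiplier is a function $\varphi:\Omega\to\mathcal{B}(\mathcal{E})$ with $\varphi f\in\mathcal{H}$ for all $f\in\mathcal{H}$; $M_\varphi$ is the (bounded) operator $f\mapsto\varphi f$, and $\mathcal{H}$ is called a module if $z_j\mathcal{H}\subseteq\mathcal{H}$ for $j=1,\dots,n$ (similarly for scalar functions). A submodule is a closed subspace invariant under all $M_{z_j}$,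 and two modules are unitarily equivalent if there is a unitary $U$ between them with $UM_{z_j}=M_{z_j}U$ for all $j$. Assume: 1. $\mathcal{H}_{k_1}$ is a module. 2. $\mathbb{C}[z_1,\dots,z_n]\subseteq\mathcal{H}_{k_1}\cap\mathcal{H}_{k_2}$, and $\mathbb{C}[z_1,\dots,z_n]$ is dense in $\mathcal{H}_{k_1}$. 3. The multipliers of $\mathcal{H}_{k_1}\otimes\mathcal{E}$ are exactly the bounded holomorphic functions $\varphi:\Omega\to\mathcal{B}(\mathcal{E})$, and $\|M_\varphi\|=\sup_{z\in\Omega}\|\varphi(z)\|$ on $\mathcal{H}_{k_1}\otimes\mathcal{E}$ for each such $\varphi$. 4. For any $z,w\in\Omega$ there are finitely many points $z=\lambda_1,\dots,\lambda_m=w$ in $\Omega$ with $k_1(\lambda_j,\lambda_{j+1})\neq0$ for $1\le j\le m-1$. Then the following hold. (i) Each multiplier $\varphi$ of $\mathcal{H}_{k_1}\otimes\mathcal{E}$ is a multiplier of $\mathcal{H}_{k_1k_2}\otimes\mathcal{E}$, and $M_\varphi$ is isometric on $\mathcal{H}_{k_1k_2}\otimes\mathcal{E}$ if and only if there is an isometry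 $V\in\mathcal{B}(\mathcal{E})$ such that $M_\varphi=I_{\mathcal{H}_{k_1k_2}}\otimes V$. (ii) $\mathcal{H}_{k_1k_2}\otimes\mathcal{E}$ is a module. Let $\mathcal{S}$ be a submodule of it. If $\mathcal{S}=\mathcal{H}_{k_1k_2}\otimes\tilde{\mathcal{E}}$ for some closed subspace $\tilde{\mathcal{E}}\subseteq\mathcal{E}$ that is isometrically isomorphic to $\mathcal{E}$ (that is, $\dim\tilde{\mathcal{E}}=\dim\mathcal{E}$), then $\mathcal{S}$ is unitarily equivalent to $\mathcal{H}_{k_1k_2}\otimes\mathcal{E}$. Conversely, if $\mathbb{C}[z_1,\dots,z_n]$ is also dense in $\mathcal{H}_{k_1k_2}$ and $\mathcal{S}$ is unitarily equivalent to $\mathcal{H}_{k_1k_2}\otimes\mathcal{E}$, then $\mathcal{S}=\mathcal{H}_{k_1k_2}\otimes\tilde{\mathcal{E}}$ for such a subspace $\tilde{\mathcal{E}}$. -/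

import Mathlib

open scoped TensorProduct InnerProductSpace

noncomputable section

namespace RKHS

/-! ### Scalar kernels -/

section Scalar

variable {X : Type*}

/-- The scalar reproducing kernel `k` of a Hilbert space `H` of complex functions on `X`. -/
def scalarKernel (H : Type*) [NormedAddCommGroup H] [InnerProductSpace ℂ H] [CompleteSpace H]
    [RKHS ℂ H X ℂ] (x y : X) : ℂ :=
  kernel H x y 1

/-- The product `k₁ k₂` of two scalar kernels, as a matrix of operators on `ℂ`. -/
def productKernel (H₁ H₂ : Type*)
    [NormedAddCommGroup H₁] [InnerProductSpace ℂ H₁] [CompleteSpace H₁] [RKHS ℂ H₁ X ℂ]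
    [NormedAddCommGroup H₂] [InnerProductSpace ℂ H₂] [CompleteSpace H₂] [RKHS ℂ H₂ X ℂ] :
    Matrix X X (ℂ →L[ℂ] ℂ) :=
  .of fun x y => (scalarKernel H₁ x y * scalarKernel H₂ x y) • ContinuousLinearMap.id ℂ ℂ

/-- The relation `∼_k`: two points are related when they are joined by a finite chain along which
`k` does not vanish. -/
def KernelChain (H : Type*) [NormedAddCommGroup H] [InnerProductSpace ℂ H] [CompleteSpace H]
    [RKHS ℂ H X ℂ] : X → X → Prop :=
  Relation.ReflTransGen fun x y => scalarKernel H x y ≠ 0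

theorem scalarKernel_eq_inner (H : Type*) [NormedAddCommGroup H] [InnerProductSpace ℂ H]
    [CompleteSpace H] [RKHS ℂ H X ℂ] (x y : X) :
    scalarKernel H x y = ⟪kerFun H x (1 : ℂ), kerFun H y (1 : ℂ)⟫_ℂ := by
  rw [kerFun_inner, kerFun_apply]
  simp [scalarKernel]

theorem scalarKernel_conj (H : Type*) [NormedAddCommGroup H] [InnerProductSpace ℂ H]
    [CompleteSpace H] [RKHS ℂ H X ℂ] (x y : X) :
    (starRingEnd ℂ) (scalarKernel H x y) = scalarKernel H y x := by
  rw [scalarKernel_eq_inner, scalarKernel_eq_inner, inner_conj_symm]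

theorem productKernel_posSemidef (H₁ H₂ : Type*)
    [NormedAddCommGroup H₁] [InnerProductSpace ℂ H₁] [CompleteSpace H₁] [RKHS ℂ H₁ X ℂ]
    [NormedAddCommGroup H₂] [InnerProductSpace ℂ H₂] [CompleteSpace H₂] [RKHS ℂ H₂ X ℂ] :
    (productKernel (X := X) H₁ H₂).PosSemidef := by
  refine ((posSemidef_tfae (K := productKernel (X := X) H₁ H₂)).out 0 2).2 ?_
  constructor
  · ext x y
    have hid : star (ContinuousLinearMap.id ℂ ℂ) = ContinuousLinearMap.id ℂ ℂ := star_one _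
    simp only [productKernel, Matrix.conjTranspose_apply, Matrix.of_apply, star_smul, star_mul',
      RCLike.star_def, scalarKernel_conj, hid]
  · intro v
    let Φ : X → ℂ → H₁ ⊗[ℂ] H₂ := fun x w => kerFun H₁ x (1 : ℂ) ⊗ₜ[ℂ] (w • kerFun H₂ x (1 : ℂ))
    have key : ∀ x w x' w', ⟪productKernel (X := X) H₁ H₂ x' x w, w'⟫_ℂ = ⟪Φ x w, Φ x' w'⟫_ℂ := by
      intro x w x' w'
      have h1 := scalarKernel_conj H₁ x' x
      have h2 := scalarKernel_conj H₂ x' x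
      simp only [Φ, TensorProduct.inner_tmul, inner_smul_left, inner_smul_right,
        ← scalarKernel_eq_inner]
      simp [productKernel, h1, h2]
      ring
    have : (v.sum fun x w => v.sum fun x' w' => ⟪productKernel (X := X) H₁ H₂ x' x w, w'⟫_ℂ)
        = ⟪v.sum Φ, v.sum Φ⟫_ℂ := by
      simp only [key, Finsupp.sum, sum_inner, inner_sum]
      exact Finset.sum_comm
    rw [this]
    exact inner_self_nonneg (𝕜 := ℂ) (x := v.sum Φ)

instance productKernel_fact (H₁ H₂ : Type*)
    [NormedAddCommGroup H₁] [InnerProductSpace ℂ H₁] [CompleteSpace H₁] [RKHS ℂ H₁ X ℂ]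
    [NormedAddCommGroup H₂] [InnerProductSpace ℂ H₂] [CompleteSpace H₂] [RKHS ℂ H₂ X ℂ] :
    Fact (productKernel (X := X) H₁ H₂).PosSemidef :=
  ⟨productKernel_posSemidef H₁ H₂⟩

/-- The reproducing kernel Hilbert space with kernel `k₁ k₂`. -/
abbrev ProductSpace (H₁ H₂ : Type*)
    [NormedAddCommGroup H₁] [InnerProductSpace ℂ H₁] [CompleteSpace H₁] [RKHS ℂ H₁ X ℂ]
    [NormedAddCommGroup H₂] [InnerProductSpace ℂ H₂] [CompleteSpace H₂] [RKHS ℂ H₂ X ℂ] : Type _ :=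
  OfKernel (productKernel (X := X) H₁ H₂)

theorem scalarKernel_productSpace (H₁ H₂ : Type*)
    [NormedAddCommGroup H₁] [InnerProductSpace ℂ H₁] [CompleteSpace H₁] [RKHS ℂ H₁ X ℂ]
    [NormedAddCommGroup H₂] [InnerProductSpace ℂ H₂] [CompleteSpace H₂] [RKHS ℂ H₂ X ℂ] (x y : X) :
    scalarKernel (ProductSpace (X := X) H₁ H₂) x y =
      scalarKernel H₁ x y * scalarKernel H₂ x y := by
  rw [scalarKernel, OfKernel.kernel_ofKernel]
  simp [productKernel]

theorem kernelChain_of_ne_zero (H : Type*) [NormedAddCommGroup H] [InnerProductSpace ℂ H]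
    [CompleteSpace H] [RKHS ℂ H X ℂ] {x y : X} (h : scalarKernel H x y ≠ 0) :
    KernelChain H x y :=
  Relation.ReflTransGen.single h

end Scalar

/-! ### The Hilbert space tensor product `H ⊗ E` as a space of `E`-valued functions -/

/-- The Hilbert space tensor product (the completed algebraic tensor product). -/
def HilbertTensor (H E : Type*) [NormedAddCommGroup H] [InnerProductSpace ℂ H]
    [NormedAddCommGroup E] [InnerProductSpace ℂ E] : Type _ :=
  UniformSpace.Completion (H ⊗[ℂ] E)

namespace HilbertTensor

section Basic

variable (H E : Type*) [NormedAddCommGroup H] [InnerProductSpace ℂ H]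
  [NormedAddCommGroup E] [InnerProductSpace ℂ E]

instance : NormedAddCommGroup (HilbertTensor H E) :=
  inferInstanceAs (NormedAddCommGroup (UniformSpace.Completion (H ⊗[ℂ] E)))

instance : InnerProductSpace ℂ (HilbertTensor H E) :=
  inferInstanceAs (InnerProductSpace ℂ (UniformSpace.Completion (H ⊗[ℂ] E)))

instance : CompleteSpace (HilbertTensor H E) :=
  inferInstanceAs (CompleteSpace (UniformSpace.Completion (H ⊗[ℂ] E)))

/-- The isometric embedding of the algebraic tensor product. -/
def incl : H ⊗[ℂ] E →ₗᵢ[ℂ] HilbertTensor H E :=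
  (UniformSpace.Completion.toComplₗᵢ : H ⊗[ℂ] E →ₗᵢ[ℂ] UniformSpace.Completion (H ⊗[ℂ] E))

theorem denseRange_incl : DenseRange (incl H E) :=
  UniformSpace.Completion.denseRange_coe

variable {H E}

/-- The elementary tensor `f ⊗ e`. -/
def tmul (f : H) (e : E) : HilbertTensor H E := incl H E (f ⊗ₜ[ℂ] e)

theorem inner_tmul (f g : H) (e e' : E) :
    ⟪tmul f e, tmul g e'⟫_ℂ = ⟪f, g⟫_ℂ * ⟪e, e'⟫_ℂ := by
  simp [tmul]

/-- An element orthogonal to all elementary tensors vanishes. -/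
theorem eq_zero_of_inner_tmul (F : HilbertTensor H E)
    (h : ∀ (f : H) (e : E), ⟪F, tmul f e⟫_ℂ = 0) : F = 0 := by
  refine (denseRange_incl H E).eq_zero_of_inner_left ℂ fun t => ?_
  induction t with
  | zero => simp
  | tmul f e => exact h f e
  | add a b ha hb => rw [map_add, inner_add_right, ha, hb, add_zero]

/-- The operator `I_H ⊗ V` on `H ⊗ E`. -/
def idTensor (H : Type*) [NormedAddCommGroup H] [InnerProductSpace ℂ H] (V : E →L[ℂ] E) :
    HilbertTensor H E →L[ℂ] HilbertTensor H E :=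
  ((V.lTensor H).completion :
    UniformSpace.Completion (H ⊗[ℂ] E) →L[ℂ] UniformSpace.Completion (H ⊗[ℂ] E))

theorem idTensor_tmul (V : E →L[ℂ] E) (f : H) (e : E) :
    idTensor H V (tmul f e) = tmul f (V e) := by
  exact (V.lTensor H).completion_apply_coe (f ⊗ₜ[ℂ] e)

/-- The closed subspace `H ⊗ E'` of `H ⊗ E`, for a subspace `E'` of `E`. -/
def tensorSubspace (H : Type*) [NormedAddCommGroup H] [InnerProductSpace ℂ H]
    (E' : Submodule ℂ E) : Submodule ℂ (HilbertTensor H E) :=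
  (Submodule.span ℂ {F | ∃ f : H, ∃ e ∈ E', tmul f e = F}).topologicalClosure

end Basic

section Functions

variable {X H E : Type*} [NormedAddCommGroup H] [InnerProductSpace ℂ H] [CompleteSpace H]
  [RKHS ℂ H X ℂ] [NormedAddCommGroup E] [InnerProductSpace ℂ E]

/-- The map `e ↦ k(·, x) ⊗ e`. -/
def kerTensor (x : X) : E →L[ℂ] HilbertTensor H E :=
  (incl H E).toContinuousLinearMap ∘L TensorProduct.mkL ℂ H E (kerFun H x (1 : ℂ))

theorem kerTensor_apply (x : X) (e : E) :
    kerTensor (H := H) x e = tmul (kerFun H x (1 : ℂ)) e := rfl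

variable [CompleteSpace E]

/-- `H ⊗ E` as a space of `E`-valued functions on `X`: the elementary tensor `f ⊗ e` is the function
`x ↦ f x • e` (see `tmul_apply`), and the value of `F` at `x` is determined by
`⟪F x, e⟫ = ⟪F, k(·, x) ⊗ e⟫`. -/
instance instRKHS : RKHS ℂ (HilbertTensor H E) X E where
  coeCLM := .pi fun x => (kerTensor (H := H) (E := E) x).adjoint
  coeCLM_injective := by
    refine (injective_iff_map_eq_zero _).mpr fun F hF => ?_
    refine eq_zero_of_inner_tmul F fun f e => ?_
    have h0 : ∀ (x : X) (e : E), ⟪F, tmul (kerFun H x (1 : ℂ)) e⟫_ℂ = 0 := by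
      intro x e
      have h := congrFun hF x
      rw [← kerTensor_apply, ← ContinuousLinearMap.adjoint_inner_left]
      have h' : (kerTensor (H := H) (E := E) x).adjoint F = 0 := h
      rw [h', inner_zero_left]
    let L : H →L[ℂ] ℂ := (innerSL ℂ F) ∘L (incl H E).toContinuousLinearMap ∘L
      (TensorProduct.mkL ℂ H E).flip e
    have hL : ∀ g, L g = ⟪F, tmul g e⟫_ℂ := fun g => rfl
    have hker : (⊤ : Submodule ℂ H) ≤ L.ker := by
      rw [← kerFun_dense H]
      refine Submodule.topologicalClosure_minimal _ ?_ L.isClosed_ker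
      rw [Submodule.span_le]
      rintro _ ⟨x, c, rfl⟩
      have hc : kerFun H x c = c • kerFun H x (1 : ℂ) := by
        rw [← map_smul, smul_eq_mul, mul_one]
      change L _ = 0
      rw [hc, map_smul, hL, h0, smul_zero]
    exact hker (Submodule.mem_top (x := f))

theorem inner_kerTensor (F : HilbertTensor H E) (x : X) (e : E) :
    ⟪F, tmul (kerFun H x (1 : ℂ)) e⟫_ℂ = ⟪F x, e⟫_ℂ := by
  rw [← kerTensor_apply, ← ContinuousLinearMap.adjoint_inner_left]
  rfl

theorem tmul_apply (f : H) (e : E) (x : X) : (tmul f e : HilbertTensor H E) x = f x • e := by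
  refine ext_inner_right ℂ fun e' => ?_
  rw [← inner_kerTensor, inner_tmul, inner_kerFun, inner_smul_left]
  simp

/-- The reproducing kernel of `H ⊗ E` is the quasiscalar kernel `k I_E`. -/
theorem kernel_eq (x y : X) :
    kernel (HilbertTensor H E) x y = scalarKernel H x y • ContinuousLinearMap.id ℂ E := by
  ext e
  have : kerFun (HilbertTensor H E) y e = tmul (kerFun H y (1 : ℂ)) e := by
    refine ext_inner_left ℂ fun F => ?_
    rw [inner_kerFun, inner_kerTensor]
  rw [← kerFun_apply, this, tmul_apply, kerFun_apply]
  rfl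

end Functions

end HilbertTensor

/-! ### Multipliers -/

section Multipliers

variable {X H V : Type*} [NormedAddCommGroup V] [InnerProductSpace ℂ V]
  [NormedAddCommGroup H] [InnerProductSpace ℂ H] [RKHS ℂ H X V]

/-- `φ` is a multiplier of `H`: `φ f ∈ H` for every `f ∈ H`. -/
def IsMultiplier (H : Type*) [NormedAddCommGroup H] [InnerProductSpace ℂ H] [RKHS ℂ H X V]
    (φ : X → V →L[ℂ] V) : Prop :=
  ∀ f : H, ∃ g : H, ∀ x, g x = φ x (f x)

/-- The multiplication operator `f ↦ φ f` as a linear map. -/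
def mulLin {φ : X → V →L[ℂ] V} (hφ : IsMultiplier H φ) : H →ₗ[ℂ] H where
  toFun f := (hφ f).choose
  map_add' f g := by
    ext x
    rw [(hφ (f + g)).choose_spec x, coe_add, coe_add, Pi.add_apply, Pi.add_apply, map_add,
      (hφ f).choose_spec x, (hφ g).choose_spec x]
  map_smul' c f := by
    ext x
    rw [(hφ (c • f)).choose_spec x, RingHom.id_apply, coe_smul, coe_smul, Pi.smul_apply,
      Pi.smul_apply, map_smul, (hφ f).choose_spec x]

@[simp]
theorem mulLin_apply {φ : X → V →L[ℂ] V} (hφ : IsMultiplier H φ) (f : H) (x : X) :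
    mulLin hφ f x = φ x (f x) :=
  (hφ f).choose_spec x

/-- The bounded multiplication operator `M_φ` (bounded by the closed graph theorem). -/
def mulOp [CompleteSpace H] {φ : X → V →L[ℂ] V} (hφ : IsMultiplier H φ) : H →L[ℂ] H :=
  ContinuousLinearMap.ofSeqClosedGraph (g := mulLin hφ) (by
    intro u f g hu hg
    ext x
    have h1 := ((continuous_eval (H := H) x).tendsto g).comp hg
    have h2 := ((φ x).continuous.tendsto _).comp (((continuous_eval (H := H) x).tendsto f).comp hu)
    refine tendsto_nhds_unique h1 ?_
    rw [mulLin_apply]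
    refine h2.congr fun n => ?_
    simp)

theorem mulOp_apply [CompleteSpace H] {φ : X → V →L[ℂ] V} (hφ : IsMultiplier H φ) (f : H) (x : X) :
    mulOp hφ f x = φ x (f x) :=
  mulLin_apply hφ f x

/-- A subspace of a reproducing kernel Hilbert space is again a space of functions. -/
instance instSubmodule (S : Submodule ℂ H) : RKHS ℂ S X V where
  coeCLM := (coeCLM ℂ : H →L[ℂ] X → V) ∘L S.subtypeL
  coeCLM_injective := (coeCLM_injective (H := H)).comp Subtype.val_injective

theorem coe_submodule (S : Submodule ℂ H) (f : S) (x : X) : f x = (f : H) x := rfl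

end Multipliers

/-! ### Modules over the polynomials -/

section Modules

variable {n : ℕ} {Ω : Set (Fin n → ℂ)} {V : Type*} [NormedAddCommGroup V] [InnerProductSpace ℂ V]

/-- A function on `Ω` is holomorphic (meant for open `Ω`). -/
def IsHolomorphic {F : Type*} [NormedAddCommGroup F] [NormedSpace ℂ F] (f : Ω → F) : Prop :=
  ∃ g : (Fin n → ℂ) → F, DifferentiableOn ℂ g Ω ∧ ∀ z : Ω, g z = f z

/-- Multiplication by the coordinate function `z_j`. -/
def coordMul (j : Fin n) (z : Ω) : V →L[ℂ] V := z.1 j • ContinuousLinearMap.id ℂ V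

/-- `z_j H ⊆ H` for all `j`. For a closed subspace `S` of a reproducing kernel Hilbert space,
`IsModule S` says that `S` is invariant under all `M_{z_j}`. -/
def IsModule (H : Type*) [NormedAddCommGroup H] [InnerProductSpace ℂ H] [RKHS ℂ H Ω V] : Prop :=
  ∀ j : Fin n, IsMultiplier H (coordMul j : Ω → V →L[ℂ] V)

/-- Unitary equivalence of modules: a unitary `U` with `U M_{z_j} = M_{z_j} U` for all `j`. -/
def UnitarilyEquivalent {V₁ V₂ H₁ H₂ : Type*}
    [NormedAddCommGroup V₁] [InnerProductSpace ℂ V₁] [NormedAddCommGroup V₂]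
    [InnerProductSpace ℂ V₂]
    [NormedAddCommGroup H₁] [InnerProductSpace ℂ H₁] [RKHS ℂ H₁ Ω V₁]
    [NormedAddCommGroup H₂] [InnerProductSpace ℂ H₂] [RKHS ℂ H₂ Ω V₂]
    (h₁ : IsModule (Ω := Ω) H₁) (h₂ : IsModule (Ω := Ω) H₂) : Prop :=
  ∃ U : H₁ ≃ₗᵢ[ℂ] H₂, ∀ (j : Fin n) (f : H₁), U (mulLin (h₁ j) f) = mulLin (h₂ j) (U f)

/-- `f` is the restriction to `Ω` of the polynomial `p`. -/
def IsPoly (f : Ω → ℂ) (p : MvPolynomial (Fin n) ℂ) : Prop :=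
  ∀ z : Ω, f z = MvPolynomial.eval z.1 p

/-- All polynomials belong to `H`. -/
def ContainsPolys (H : Type*) [NormedAddCommGroup H] [InnerProductSpace ℂ H] [RKHS ℂ H Ω ℂ] :
    Prop :=
  ∀ p : MvPolynomial (Fin n) ℂ, ∃ f : H, IsPoly f p

/-- The polynomials in `H` are dense in `H`. -/
def DensePolys (H : Type*) [NormedAddCommGroup H] [InnerProductSpace ℂ H] [RKHS ℂ H Ω ℂ] :
    Prop :=
  Dense {f : H | ∃ p : MvPolynomial (Fin n) ℂ, IsPoly f p}

end Modules

end RKHS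

end

/-! Everything rests on the isometry `J` from the space with kernel `k₁k₂ I_E` into `H₂ ⊗ (H₁ ⊗ E)`
sending `k₁k₂(·, x) ⊗ e` to `k₂(·, x) ⊗ (k₁(·, x) ⊗ e)`. Its adjoint is restriction to the diagonal,
and for a multiplier `φ` of `H₁ ⊗ E` the compression `J* (I ⊗ M_φ) J` is `M_φ` on the product space
(`compression_apply`).

If this compression is isometric, then `‖φ(z)‖ ≤ 1` everywhere, so `M_φ` is a contraction on `H₁ ⊗
E` by the sup-norm formula. A contraction whose compression preserves norms maps `ran J` into
itself. Thus `k₂(·, z) ⊗ M_φ (k₁(·, z) ⊗ e)` is orthogonal to `ker J*`, which contains `1 ⊗ (p ⊗ e')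
- p ⊗ (1 ⊗ e')`. By density of polynomials `M_φ (k₁(·, z) ⊗ e)` has the form `k₁(·, z) ⊗ ξ`, so
`φ(w) = φ(z)` whenever `k₁(z, w) ≠ 0`; chains make `φ` constant (`eq_of_isometry_mulOp`).

For the converse in (ii), a unitary equivalence gives an isometry `W` with range `S` commuting with
all `M_{z_j}`. Density of polynomials makes it some `M_φ` with `φ` holomorphic and bounded, so (i)
applies and `W = I ⊗ V`. Norm holomorphy of `φ` follows from that of point evaluations, by
Banach–Steinhaus and the Schwarz lemma. -/

/-! ### Pointwise versus norm holomorphy -/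

open Metric in
/-- Quadratic remainder estimate for the first order Taylor expansion of a bounded holomorphic
function on a disc. -/
theorem Complex.norm_sub_sub_smul_deriv_le {F : Type*} [NormedAddCommGroup F] [NormedSpace ℂ F]
    [CompleteSpace F] {f : ℂ → F} {R C : ℝ} (hd : DifferentiableOn ℂ f (ball 0 R))
    (hC : ∀ t ∈ ball (0 : ℂ) R, ‖f t‖ ≤ C) {t : ℂ} (ht : t ∈ ball (0 : ℂ) R) :
    ‖f t - f 0 - t • deriv f 0‖ ≤ 4 * C / R ^ 2 * ‖t‖ ^ 2 := by
  have hR : 0 < R := pos_of_mem_ball ht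
  have h0 : (0 : ℂ) ∈ ball (0 : ℂ) R := mem_ball_self hR
  have hnhds : ball (0 : ℂ) R ∈ nhds (0 : ℂ) := ball_mem_nhds 0 hR
  -- Schwarz lemma twice: `f` stays within `2C` of `f 0`, so its slope is at most `2C/R`; the slope
  -- then stays within `4C/R` of its value at `0`, whence `4C/R²`.
  have h1 : ∀ s ∈ ball (0 : ℂ) R, ‖dslope f 0 s‖ ≤ 2 * C / R := fun s hs =>
    norm_dslope_le_div_of_mapsTo_ball hd (fun u hu => by
      rw [mem_closedBall, dist_eq_norm]
      linarith [norm_sub_le (f u) (f 0), hC u hu, hC 0 h0]) hs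
  have h2 : ‖dslope (dslope f 0) 0 t‖ ≤ 2 * (2 * C / R) / R :=
    norm_dslope_le_div_of_mapsTo_ball ((differentiableOn_dslope hnhds).2 hd) (fun u hu => by
      rw [mem_closedBall, dist_eq_norm]
      linarith [norm_sub_le (dslope f 0 u) (dslope f 0 0), h1 u hu, h1 0 h0]) ht
  have e1 := sub_smul_dslope f 0 t
  have e2 := sub_smul_dslope (dslope f 0) 0 t
  rw [dslope_same] at e2
  rw [sub_zero] at e1 e2
  rw [← e1, ← smul_sub, ← e2, norm_smul, norm_smul]
  calc ‖t‖ * (‖t‖ * ‖dslope (dslope f 0) 0 t‖) ≤ ‖t‖ * (‖t‖ * (2 * (2 * C / R) / R)) := by gcongr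
    _ = _ := by field_simp; ring

/-- A family of bounded operators which is pointwise holomorphic on an open set is holomorphic for
the operator norm. -/
theorem DifferentiableOn.of_forall_clm_apply {M G F : Type*}
    [NormedAddCommGroup M] [NormedSpace ℂ M] [FiniteDimensional ℂ M]
    [NormedAddCommGroup G] [NormedSpace ℂ G] [CompleteSpace G]
    [NormedAddCommGroup F] [NormedSpace ℂ F] [CompleteSpace F]
    {Ω : Set M} (hΩ : IsOpen Ω) {T : M → G →L[ℂ] F}
    (hT : ∀ g, DifferentiableOn ℂ (fun z => T z g) Ω) : DifferentiableOn ℂ T Ω := by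
  intro z₀ hz₀
  refine DifferentiableAt.differentiableWithinAt ?_
  have := FiniteDimensional.proper ℂ M
  obtain ⟨R, hR, hball⟩ := Metric.nhds_basis_closedBall.mem_iff.1 (hΩ.mem_nhds hz₀)
  obtain ⟨C, hC⟩ : ∃ C, ∀ z : Metric.closedBall z₀ R, ‖T z‖ ≤ C := by
    refine banach_steinhaus fun g => ?_
    obtain ⟨C, hC⟩ := (isCompact_closedBall z₀ R).exists_bound_of_continuousOn
      ((hT g).continuousOn.mono hball)
    exact ⟨C, fun z => hC z z.2⟩
  have hat : ∀ g, DifferentiableAt ℂ (fun z => T z g) z₀ :=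
    fun g => (hT g).differentiableAt (hΩ.mem_nhds hz₀)
  have hmem : ∀ (h : M), ‖h‖ ≤ 1 → ∀ t ∈ Metric.ball (0 : ℂ) R,
      z₀ + t • h ∈ Metric.closedBall z₀ R := by
    intro h hh t ht
    rw [mem_closedBall_iff_norm, add_sub_cancel_left, norm_smul]
    rw [mem_ball_zero_iff] at ht
    nlinarith [norm_nonneg h, norm_nonneg t]
  have hderiv : ∀ (g : G) (h : M), HasDerivAt (fun t : ℂ => T (z₀ + t • h) g)
      (fderiv ℂ (fun z => T z g) z₀ h) 0 := by
    intro g h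
    have h1 : HasDerivAt (fun t : ℂ => z₀ + t • h) h 0 := by
      simpa using ((hasDerivAt_id (0 : ℂ)).smul_const h).const_add z₀
    have h2 : HasFDerivAt (fun z => T z g) (fderiv ℂ (fun z => T z g) z₀)
        (z₀ + (0 : ℂ) • h) := by simpa using (hat g).hasFDerivAt
    exact h2.comp_hasDerivAt (0 : ℂ) h1
  -- The bound is uniform over directions in the unit ball and linear in `‖g‖`, which upgrades
  -- pointwise derivatives to an operator-norm derivative.
  have hrem : ∀ (g : G) (h : M), ‖h‖ ≤ 1 → ∀ t ∈ Metric.ball (0 : ℂ) R,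
      ‖T (z₀ + t • h) g - T z₀ g - t • fderiv ℂ (fun z => T z g) z₀ h‖ ≤
        4 * (C * ‖g‖) / R ^ 2 * ‖t‖ ^ 2 := by
    intro g h hh t ht
    have hd : DifferentiableOn ℂ (fun t : ℂ => T (z₀ + t • h) g) (Metric.ball 0 R) :=
      (hT g).comp (by fun_prop) fun s hs => hball (hmem h hh s hs)
    have hb : ∀ s ∈ Metric.ball (0 : ℂ) R, ‖T (z₀ + s • h) g‖ ≤ C * ‖g‖ := fun s hs =>
      (T _).le_of_opNorm_le (hC ⟨_, hmem h hh s hs⟩) g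
    have := Complex.norm_sub_sub_smul_deriv_le hd hb ht
    rwa [(hderiv g h).deriv, zero_smul, add_zero] at this
  -- A pointwise limit of bounded difference quotients is itself bounded, by uniform boundedness.
  let B (h : M) : G →L[ℂ] F := by
    refine continuousLinearMapOfTendsto (l := nhdsWithin (0 : ℂ) {0}ᶜ)
      (fun t : ℂ => t⁻¹ • (T (z₀ + t • h) - T z₀))
      (f := fun g => fderiv ℂ (fun z => T z g) z₀ h) ?_
    rw [tendsto_pi_nhds]
    intro g
    have := hasDerivAt_iff_tendsto_slope.1 (hderiv g h)
    refine this.congr fun t => ?_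
    simp [slope_def_module]
  have hB : ∀ h g, B h g = fderiv ℂ (fun z => T z g) z₀ h := fun h g => rfl
  let A : M →ₗ[ℂ] G →L[ℂ] F :=
    { toFun := B
      map_add' := fun h h' => by ext g; simp [hB]
      map_smul' := fun c h => by ext g; simp [hB] }
  refine HasFDerivAt.differentiableAt (f' := LinearMap.toContinuousLinearMap A) ?_
  refine HasFDerivAt.of_isLittleO ?_
  have hO : (fun z => T z - T z₀ - LinearMap.toContinuousLinearMap A (z - z₀)) =O[nhds z₀]
      fun z => ‖z - z₀‖ ^ 2 := by
    refine Asymptotics.IsBigO.of_bound (4 * C / R ^ 2) ?_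
    filter_upwards [Metric.ball_mem_nhds z₀ hR] with z hz
    rw [norm_pow, norm_norm]
    have hC0 : 0 ≤ C := (norm_nonneg _).trans (hC ⟨z₀, Metric.mem_closedBall_self hR.le⟩)
    refine ContinuousLinearMap.opNorm_le_bound _ (by positivity) fun g => ?_
    rcases eq_or_ne z z₀ with rfl | hne
    · simp
    have hpos : (‖z - z₀‖ : ℂ) ≠ 0 := by simpa [sub_eq_zero] using hne
    -- Normalised direction, with parameter `t = ‖z - z₀‖`.
    have h1 := hrem g ((‖z - z₀‖ : ℂ)⁻¹ • (z - z₀)) (by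
      rw [norm_smul, norm_inv, Complex.norm_real, norm_norm]
      exact inv_mul_le_one) (‖z - z₀‖ : ℂ) (by
        simpa [dist_eq_norm] using hz)
    rw [← map_smul, smul_inv_smul₀ hpos, add_sub_cancel, Complex.norm_real, norm_norm] at h1
    refine h1.trans_eq ?_
    ring
  refine hO.trans_isLittleO ?_
  exact Asymptotics.isLittleO_pow_sub_sub z₀ one_lt_two

namespace RKHS

namespace HilbertTensor

/-! ### Operators `I ⊗ V` -/

section Tensors

variable {H E : Type*} [NormedAddCommGroup H] [InnerProductSpace ℂ H]
  [NormedAddCommGroup E] [InnerProductSpace ℂ E]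

/-- The bounded bilinear map `(f, e) ↦ f ⊗ e`. -/
noncomputable def tmulL (H E : Type*) [NormedAddCommGroup H] [InnerProductSpace ℂ H]
    [NormedAddCommGroup E] [InnerProductSpace ℂ E] : H →L[ℂ] E →L[ℂ] HilbertTensor H E :=
  (ContinuousLinearMap.compL ℂ E (H ⊗[ℂ] E) (HilbertTensor H E)
    (incl H E).toContinuousLinearMap) ∘L TensorProduct.mkL ℂ H E

theorem tmulL_apply (f : H) (e : E) : tmulL H E f e = tmul f e := rfl

theorem norm_tmul (f : H) (e : E) : ‖(tmul f e : HilbertTensor H E)‖ = ‖f‖ * ‖e‖ := by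
  simp [tmul]

/-- A closed subspace containing all elementary tensors is everything. -/
theorem mem_of_tmul_mem {S : Submodule ℂ (HilbertTensor H E)}
    (hS : IsClosed (S : Set (HilbertTensor H E))) (h : ∀ f e, tmul f e ∈ S)
    (F : HilbertTensor H E) : F ∈ S := by
  refine (denseRange_incl H E).induction_on (p := fun F => F ∈ S) F hS fun t => ?_
  induction t with
  | zero => simp
  | tmul f e => exact h f e
  | add a b ha hb => rw [map_add]; exact S.add_mem ha hb

theorem clm_ext {G : Type*} [NormedAddCommGroup G] [NormedSpace ℂ G]
    {A B : HilbertTensor H E →L[ℂ] G} (h : ∀ f e, A (tmul f e) = B (tmul f e)) : A = B := by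
  ext F
  refine mem_of_tmul_mem (S := LinearMap.eqLocus A.toLinearMap B.toLinearMap)
    (isClosed_eq A.continuous B.continuous) h F

theorem norm_idTensor_apply_le (V : E →L[ℂ] E) (F : HilbertTensor H E) :
    ‖idTensor H V F‖ ≤ ‖V‖ * ‖F‖ := by
  refine (denseRange_incl H E).induction_on
    (p := fun F => ‖idTensor H V F‖ ≤ ‖V‖ * ‖F‖) F
    (isClosed_le (by fun_prop) (by fun_prop)) fun t => ?_
  have : idTensor H V (incl H E t) = incl H E (V.lTensor H t) :=
    (V.lTensor H).completion_apply_coe t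
  rw [this, LinearIsometry.norm_map, LinearIsometry.norm_map]
  exact ((V.lTensor H).le_opNorm t).trans
    (mul_le_mul_of_nonneg_right (ContinuousLinearMap.norm_lTensor_le _ V) (norm_nonneg t))

variable [CompleteSpace E]

theorem adjoint_idTensor (V : E →L[ℂ] E) :
    (idTensor H V).adjoint = idTensor H V.adjoint := by
  refine clm_ext fun f e => sub_eq_zero.1 (eq_zero_of_inner_tmul _ fun g e' => ?_)
  rw [inner_sub_left, ContinuousLinearMap.adjoint_inner_left, idTensor_tmul, idTensor_tmul,
    inner_tmul, inner_tmul, ContinuousLinearMap.adjoint_inner_left, sub_self]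

/-- Stated as `V* V = 1`, the isometry property need only be checked on elementary tensors. -/
theorem isometry_idTensor {V : E →L[ℂ] E} (hV : Isometry V) : Isometry (idTensor H V) := by
  have h1 : V.adjoint ∘L V = 1 := (ContinuousLinearMap.norm_map_iff_adjoint_comp_self V).1
    ((AddMonoidHomClass.isometry_iff_norm V).1 hV)
  refine (AddMonoidHomClass.isometry_iff_norm _).2
    ((ContinuousLinearMap.norm_map_iff_adjoint_comp_self _).2 (clm_ext fun f e => ?_))
  rw [ContinuousLinearMap.comp_apply, adjoint_idTensor, idTensor_tmul, idTensor_tmul,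
    ← ContinuousLinearMap.comp_apply, h1]
  rfl

theorem range_idTensor {V : E →L[ℂ] E} (hV : Isometry V) :
    (idTensor H V).range = tensorSubspace H V.range := by
  refine le_antisymm ?_ ?_
  · rintro _ ⟨F, rfl⟩
    refine mem_of_tmul_mem (S := (tensorSubspace H V.range).comap (idTensor H V).toLinearMap)
      ((Submodule.isClosed_topologicalClosure _).preimage (idTensor H V).continuous)
      (fun f e => ?_) F
    refine Submodule.le_topologicalClosure _ (Submodule.subset_span ⟨f, V e, ⟨e, rfl⟩, ?_⟩)
    exact (idTensor_tmul V f e).symm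
  · refine Submodule.topologicalClosure_minimal _ (Submodule.span_le.2 ?_) ?_
    · rintro _ ⟨f, _, ⟨e, rfl⟩, rfl⟩
      exact ⟨tmul f e, idTensor_tmul V f e⟩
    · exact (isometry_idTensor hV).isClosedEmbedding.isClosed_range

end Tensors

section Functions

variable {X H E : Type*} [NormedAddCommGroup H] [InnerProductSpace ℂ H] [CompleteSpace H]
  [RKHS ℂ H X ℂ] [NormedAddCommGroup E] [InnerProductSpace ℂ E] [CompleteSpace E]

theorem kerFun_hilbertTensor (x : X) (e : E) :
    kerFun (HilbertTensor H E) x e = tmul (kerFun H x (1 : ℂ)) e :=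
  ext_inner_left ℂ fun F => by rw [inner_kerFun, inner_kerTensor]

/-- This identifies `I ⊗ V` with multiplication by the constant function `V`. -/
theorem idTensor_apply (V : E →L[ℂ] E) (F : HilbertTensor H E) (x : X) :
    idTensor H V F x = V (F x) := by
  refine ext_inner_right ℂ fun e => ?_
  rw [← inner_kerTensor, ← ContinuousLinearMap.adjoint_inner_right, adjoint_idTensor,
    idTensor_tmul, inner_kerTensor, ContinuousLinearMap.adjoint_inner_right]

end Functions

end HilbertTensor

/-! ### Isometries defined on kernel functions -/

section Isometry

variable {X V H L : Type*} [NormedAddCommGroup V] [InnerProductSpace ℂ V] [CompleteSpace V]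
  [NormedAddCommGroup H] [InnerProductSpace ℂ H] [CompleteSpace H] [RKHS ℂ H X V]
  [NormedAddCommGroup L] [InnerProductSpace ℂ L] [CompleteSpace L]

/-- A feature map with the same Gram matrix as the kernel functions extends to an isometry. -/
theorem exists_linearIsometry_of_inner_eq (Γ : X → V →L[ℂ] L)
    (h : ∀ x y v w, ⟪Γ x v, Γ y w⟫_ℂ = ⟪kerFun H x v, kerFun H y w⟫_ℂ) :
    ∃ J : H →ₗᵢ[ℂ] L, ∀ x v, J (kerFun H x v) = Γ x v := by
  -- Kernel functions may be linearly dependent, so both maps start on formal sums; equal Gram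
  -- matrices let `f` factor through `e`.
  let f : (X →₀ V) →ₗ[ℂ] L := Finsupp.lsum ℂ fun x => (Γ x).toLinearMap
  let e : (X →₀ V) →ₗ[ℂ] H := Finsupp.lsum ℂ fun x => (kerFun H x).toLinearMap
  have hfe : ∀ u, ‖f u‖ = ‖e u‖ := by
    intro u
    have : ⟪f u, f u⟫_ℂ = ⟪e u, e u⟫_ℂ := by
      simp only [f, e, Finsupp.lsum_apply, Finsupp.sum, sum_inner, inner_sum,
        ContinuousLinearMap.coe_coe, h]
    rw [@norm_eq_sqrt_re_inner ℂ, this, ← @norm_eq_sqrt_re_inner ℂ]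
  have hdense : DenseRange e := by
    have hle : Submodule.span ℂ {kerFun H x v | (x) (v)} ≤ LinearMap.range e := by
      rw [Submodule.span_le]
      rintro _ ⟨x, v, rfl⟩
      exact ⟨Finsupp.single x v, by simp [e]⟩
    have hd : Dense ((LinearMap.range e : Submodule ℂ H) : Set H) := by
      rw [Submodule.dense_iff_topologicalClosure_eq_top, eq_top_iff, ← kerFun_dense H]
      exact Submodule.topologicalClosure_mono hle
    rwa [LinearMap.coe_range] at hd
  have hbd : ∃ C : ℝ, ∀ u, ‖f u‖ ≤ C * ‖e u‖ := ⟨1, fun u => by rw [hfe, one_mul]⟩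
  refine ⟨⟨(f.extendOfNorm e).toLinearMap, fun F => ?_⟩, fun x v => ?_⟩
  · refine hdense.induction_on (p := fun F => ‖f.extendOfNorm e F‖ = ‖F‖) F
      (isClosed_eq (by fun_prop) (by fun_prop)) fun u => ?_
    rw [LinearMap.extendOfNorm_eq hdense hbd, hfe]
  · have := LinearMap.extendOfNorm_eq hdense hbd (Finsupp.single x v)
    simpa [e, f] using this

/-- The adjoint of a multiplication operator acts on kernel functions by `φ(x)^*`. -/
theorem adjoint_mulOp_kerFun {φ : X → V →L[ℂ] V} (hφ : IsMultiplier H φ) (x : X) (v : V) :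
    (mulOp hφ).adjoint (kerFun H x v) = kerFun H x ((φ x).adjoint v) := by
  refine ext_inner_left ℂ fun F => ?_
  rw [ContinuousLinearMap.adjoint_inner_right, inner_kerFun, inner_kerFun, mulOp_apply,
    ContinuousLinearMap.adjoint_inner_right]

end Isometry

end RKHS

namespace RKHS

open HilbertTensor

/-! ### The product kernel as a diagonal restriction -/

section Product

variable {X H₁ H₂ E : Type*}
  [NormedAddCommGroup H₁] [InnerProductSpace ℂ H₁] [CompleteSpace H₁] [RKHS ℂ H₁ X ℂ]
  [NormedAddCommGroup H₂] [InnerProductSpace ℂ H₂] [CompleteSpace H₂] [RKHS ℂ H₂ X ℂ]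
  [NormedAddCommGroup E] [InnerProductSpace ℂ E] [CompleteSpace E]

theorem kerFun_eq_smul {H : Type*} [NormedAddCommGroup H] [InnerProductSpace ℂ H]
    [CompleteSpace H] [RKHS ℂ H X ℂ] (x : X) (c : ℂ) :
    kerFun H x c = c • kerFun H x (1 : ℂ) := by
  rw [← map_smul, smul_eq_mul, mul_one]

theorem kerFun_one_apply {H : Type*} [NormedAddCommGroup H] [InnerProductSpace ℂ H]
    [CompleteSpace H] [RKHS ℂ H X ℂ] (x y : X) :
    kerFun H y (1 : ℂ) x = scalarKernel H x y := by
  rw [kerFun_apply, scalarKernel]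

/-- The isometry `k₁k₂(·, x) ↦ k₁(·, x) ⊗ k₂(·, x)`. -/
theorem exists_isometry_productSpace (H₁ H₂ : Type*)
    [NormedAddCommGroup H₁] [InnerProductSpace ℂ H₁] [CompleteSpace H₁] [RKHS ℂ H₁ X ℂ]
    [NormedAddCommGroup H₂] [InnerProductSpace ℂ H₂] [CompleteSpace H₂] [RKHS ℂ H₂ X ℂ] :
    ∃ J : ProductSpace (X := X) H₁ H₂ →ₗᵢ[ℂ] HilbertTensor H₁ H₂, ∀ x,
      J (kerFun _ x (1 : ℂ)) = tmul (kerFun H₁ x (1 : ℂ)) (kerFun H₂ x (1 : ℂ)) := by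
  obtain ⟨J, hJ⟩ := exists_linearIsometry_of_inner_eq (H := ProductSpace (X := X) H₁ H₂)
    (fun x => ContinuousLinearMap.toSpanSingleton ℂ
      (tmul (kerFun H₁ x (1 : ℂ)) (kerFun H₂ x (1 : ℂ)) : HilbertTensor H₁ H₂)) (by
      intro x y v w
      rw [kerFun_eq_smul x v, kerFun_eq_smul y w]
      simp only [ContinuousLinearMap.toSpanSingleton_apply, inner_smul_left, inner_smul_right,
        HilbertTensor.inner_tmul, ← scalarKernel_eq_inner, scalarKernel_productSpace])
  exact ⟨J, fun x => by simpa using hJ x 1⟩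

/-- The isometry `k₁k₂(·, x) ⊗ e ↦ k₂(·, x) ⊗ (k₁(·, x) ⊗ e)`. -/
theorem exists_isometry_productSpace_tensor (H₁ H₂ E : Type*)
    [NormedAddCommGroup H₁] [InnerProductSpace ℂ H₁] [CompleteSpace H₁] [RKHS ℂ H₁ X ℂ]
    [NormedAddCommGroup H₂] [InnerProductSpace ℂ H₂] [CompleteSpace H₂] [RKHS ℂ H₂ X ℂ]
    [NormedAddCommGroup E] [InnerProductSpace ℂ E] [CompleteSpace E] :
    ∃ J : HilbertTensor (ProductSpace (X := X) H₁ H₂) E →ₗᵢ[ℂ]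
        HilbertTensor H₂ (HilbertTensor H₁ E), ∀ x e,
      J (kerFun _ x e) = tmul (kerFun H₂ x (1 : ℂ)) (tmul (kerFun H₁ x (1 : ℂ)) e) := by
  refine exists_linearIsometry_of_inner_eq
    (fun x => tmulL H₂ (HilbertTensor H₁ E) (kerFun H₂ x (1 : ℂ)) ∘L
      tmulL H₁ E (kerFun H₁ x (1 : ℂ))) ?_
  intro x y v w
  simp only [ContinuousLinearMap.comp_apply, tmulL_apply, HilbertTensor.inner_tmul,
    kerFun_hilbertTensor, ← scalarKernel_eq_inner, scalarKernel_productSpace]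
  ring

/-- `J*` restricts to the diagonal, so tensors with the same pointwise product differ by an element
of `ker J*`. -/
theorem adjoint_isometry_tmul_apply
    {J : HilbertTensor (ProductSpace (X := X) H₁ H₂) E →ₗᵢ[ℂ]
      HilbertTensor H₂ (HilbertTensor H₁ E)}
    (hJ : ∀ x e, J (kerFun _ x e) = tmul (kerFun H₂ x (1 : ℂ)) (tmul (kerFun H₁ x (1 : ℂ)) e))
    (f : H₂) (g : H₁) (e : E) (x : X) :
    J.toContinuousLinearMap.adjoint (tmul f (tmul g e)) x = (f x * g x) • e := by
  refine ext_inner_right ℂ fun e' => ?_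
  rw [← inner_kerFun, ContinuousLinearMap.adjoint_inner_left, LinearIsometry.coe_toContinuousLinearMap,
    hJ, HilbertTensor.inner_tmul, HilbertTensor.inner_tmul, inner_kerFun, inner_kerFun,
    inner_smul_left]
  simp [mul_assoc]

/-- The adjoint of `I ⊗ M_φ` leaves `ran J` invariant: it sends `J (k_x ⊗ e)` to `J (k_x ⊗ φ(x)*
e)`. -/
theorem compression_apply
    {J : HilbertTensor (ProductSpace (X := X) H₁ H₂) E →ₗᵢ[ℂ]
      HilbertTensor H₂ (HilbertTensor H₁ E)}
    (hJ : ∀ x e, J (kerFun _ x e) = tmul (kerFun H₂ x (1 : ℂ)) (tmul (kerFun H₁ x (1 : ℂ)) e))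
    {φ : X → E →L[ℂ] E} (hφ : IsMultiplier (HilbertTensor H₁ E) φ)
    (F : HilbertTensor (ProductSpace (X := X) H₁ H₂) E) (x : X) :
    J.toContinuousLinearMap.adjoint (idTensor H₂ (mulOp hφ) (J F)) x = φ x (F x) := by
  refine ext_inner_right ℂ fun e => ?_
  rw [← inner_kerFun, ContinuousLinearMap.adjoint_inner_left,
    LinearIsometry.coe_toContinuousLinearMap, hJ, ← ContinuousLinearMap.adjoint_inner_right,
    adjoint_idTensor, idTensor_tmul, ← kerFun_hilbertTensor (H := H₁), adjoint_mulOp_kerFun,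
    kerFun_hilbertTensor, ← hJ, LinearIsometry.inner_map_map, inner_kerFun,
    ContinuousLinearMap.adjoint_inner_right]

/-- A multiplier of `H₁ ⊗ E` is a multiplier of the space with kernel `k₁k₂ I_E`. -/
theorem IsMultiplier.productSpace {φ : X → E →L[ℂ] E}
    (hφ : IsMultiplier (HilbertTensor H₁ E) φ) :
    IsMultiplier (HilbertTensor (ProductSpace (X := X) H₁ H₂) E) φ := by
  obtain ⟨J, hJ⟩ := exists_isometry_productSpace_tensor (X := X) H₁ H₂ E
  exact fun F => ⟨_, compression_apply hJ hφ F⟩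

/-- If the compression of a contraction to the range of an isometry preserves the norm of a vector,
then the contraction maps this vector into the range. -/
theorem apply_adjoint_apply_of_norm_eq {G L : Type*} [NormedAddCommGroup G]
    [InnerProductSpace ℂ G] [CompleteSpace G] [NormedAddCommGroup L] [InnerProductSpace ℂ L]
    [CompleteSpace L] (J : G →ₗᵢ[ℂ] L) {y : L}
    (h : ‖y‖ ≤ ‖J.toContinuousLinearMap.adjoint y‖) :
    J (J.toContinuousLinearMap.adjoint y) = y := by
  set u := J.toContinuousLinearMap.adjoint y with hu
  have h1 : RCLike.re ⟪J u, y⟫_ℂ = ‖u‖ ^ 2 := by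
    rw [← LinearIsometry.coe_toContinuousLinearMap, ← ContinuousLinearMap.adjoint_inner_right,
      ← hu, inner_self_eq_norm_sq]
  -- Since `J J*` is a projection, `‖J J* y - y‖² = ‖y‖² - ‖J* y‖²`.
  have h2 := norm_sub_sq (𝕜 := ℂ) (J u) y
  rw [h1, J.norm_map] at h2
  have h3 : ‖J u - y‖ ^ 2 ≤ 0 := by
    rw [h2]
    nlinarith [norm_nonneg y, norm_nonneg u]
  exact sub_eq_zero.1 (norm_eq_zero.1 (by nlinarith [norm_nonneg (J u - y)]))

/-- A multiplier is bounded by the norm of its multiplication operator where the kernel does not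
vanish. -/
theorem norm_le_norm_mulOp {H : Type*} [NormedAddCommGroup H] [InnerProductSpace ℂ H]
    [CompleteSpace H] [RKHS ℂ H X ℂ] {φ : X → E →L[ℂ] E} (W : HilbertTensor H E →L[ℂ] HilbertTensor H E)
    (hW : ∀ F x, W F x = φ x (F x)) {x : X}
    (hx : scalarKernel H x x ≠ 0) : ‖φ x‖ ≤ ‖W‖ := by
  have hφ : IsMultiplier (HilbertTensor H E) φ := fun F => ⟨W F, hW F⟩
  have hWφ : mulOp hφ = W := by
    refine ContinuousLinearMap.ext fun F => RKHS.ext fun x => ?_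
    rw [mulOp_apply, hW]
  have hk : 0 < ‖kerFun H x (1 : ℂ)‖ := by
    rw [scalarKernel_eq_inner] at hx
    exact norm_pos_iff.2 fun h => hx (by rw [h, inner_zero_left])
  -- The adjoint of `M_φ` sends `k_x ⊗ e` to `k_x ⊗ φ(x)* e`; the factor `‖k_x‖` then cancels.
  rw [← LinearIsometryEquiv.norm_map ContinuousLinearMap.adjoint (φ x),
    ← LinearIsometryEquiv.norm_map ContinuousLinearMap.adjoint W, ← hWφ]
  refine ContinuousLinearMap.opNorm_le_bound _ (norm_nonneg _) fun e => ?_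
  have h1 := (mulOp hφ).adjoint.le_opNorm (kerFun (HilbertTensor H E) x e)
  rw [adjoint_mulOp_kerFun, kerFun_hilbertTensor, kerFun_hilbertTensor,
    HilbertTensor.norm_tmul, HilbertTensor.norm_tmul] at h1
  refine le_of_mul_le_mul_left (h1.trans_eq ?_) hk
  ring

end Product

/-! ### Isometric multipliers are constant -/

section Constant

variable {n : ℕ} {Ω : Set (Fin n → ℂ)} {H₁ H₂ E : Type*}
  [NormedAddCommGroup H₁] [InnerProductSpace ℂ H₁] [CompleteSpace H₁] [RKHS ℂ H₁ Ω ℂ]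
  [NormedAddCommGroup H₂] [InnerProductSpace ℂ H₂] [CompleteSpace H₂] [RKHS ℂ H₂ Ω ℂ]
  [NormedAddCommGroup E] [InnerProductSpace ℂ E] [CompleteSpace E]

theorem scalarKernel_self_ne_zero {H : Type*} [NormedAddCommGroup H] [InnerProductSpace ℂ H]
    [CompleteSpace H] [RKHS ℂ H Ω ℂ] (hpoly : ContainsPolys H) (z : Ω) :
    scalarKernel H z z ≠ 0 := by
  obtain ⟨f, hf⟩ := hpoly 1
  intro h
  rw [scalarKernel_eq_inner, inner_self_eq_zero] at h
  have h1 : ⟪kerFun H z (1 : ℂ), f⟫_ℂ = 1 := by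
    rw [kerFun_inner, hf z]
    simp
  rw [h, inner_zero_left] at h1
  exact zero_ne_one h1

/-- If the contractive multiplier `φ` of `H₁ ⊗ E` is isometric on the space with kernel
`k₁k₂ I_E`, then it is constant along chains. -/
theorem eq_of_isometry_mulOp (hpoly₁ : ContainsPolys H₁) (hpoly₂ : ContainsPolys H₂)
    (hdense : DensePolys H₁) {φ : Ω → E →L[ℂ] E} (hφ₁ : IsMultiplier (HilbertTensor H₁ E) φ)
    (hnorm : ‖mulOp hφ₁‖ ≤ 1)
    (hφ : IsMultiplier (HilbertTensor (ProductSpace (X := Ω) H₁ H₂) E) φ)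
    (hiso : Isometry (mulOp hφ)) {z w : Ω} (hzw : scalarKernel H₁ z w ≠ 0) : φ w = φ z := by
  obtain ⟨J, hJ⟩ := exists_isometry_productSpace_tensor (X := Ω) H₁ H₂ E
  obtain ⟨u₁, hu₁⟩ := hpoly₁ 1
  obtain ⟨u₂, hu₂⟩ := hpoly₂ 1
  have hadj : ∀ F, J.toContinuousLinearMap.adjoint (idTensor H₂ (mulOp hφ₁) (J F)) =
      mulOp hφ F := fun F =>
    RKHS.ext fun x => by rw [compression_apply hJ, mulOp_apply]
  have hran : ∀ F, J (J.toContinuousLinearMap.adjoint (idTensor H₂ (mulOp hφ₁) (J F))) =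
      idTensor H₂ (mulOp hφ₁) (J F) := by
    refine fun F => apply_adjoint_apply_of_norm_eq J ?_
    rw [hadj, (AddMonoidHomClass.isometry_iff_norm _).1 hiso F, ← J.norm_map F]
    exact (norm_idTensor_apply_le _ _).trans (mul_le_of_le_one_left (norm_nonneg _) hnorm)
  have key : ∀ (e e' : E) (f : H₁), ⟪mulOp hφ₁ (tmul (kerFun H₁ z (1 : ℂ)) e), tmul f e'⟫_ℂ =
      f z * ⟪mulOp hφ₁ (tmul (kerFun H₁ z (1 : ℂ)) e), tmul u₁ e'⟫_ℂ := by
    intro e e' f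
    set y := mulOp hφ₁ (tmul (kerFun H₁ z (1 : ℂ)) e) with hy
    have hcont : Continuous fun f : H₁ => ⟪y, tmul f e'⟫_ℂ :=
      (innerSL ℂ y ∘L (tmulL H₁ E).flip e').continuous
    refine hdense.induction (P := fun f => ⟪y, tmul f e'⟫_ℂ = f z * ⟪y, tmul u₁ e'⟫_ℂ) ?_
      (isClosed_eq hcont ((continuous_eval z).mul_const _)) f
    rintro f ⟨p, hp⟩
    obtain ⟨q, hq⟩ := hpoly₂ p
    -- Both tensors restrict to `p e'` on the diagonal; this is where `p` must lie in both spaces.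
    have h1 : J.toContinuousLinearMap.adjoint (tmul u₂ (tmul f e')) =
        J.toContinuousLinearMap.adjoint (tmul q (tmul u₁ e')) := by
      refine RKHS.ext fun x => ?_
      rw [adjoint_isometry_tmul_apply hJ, adjoint_isometry_tmul_apply hJ, hu₁ x, hu₂ x, hp x, hq x,
        mul_comm]
    have h2 : ∀ (g : H₂) (h : H₁), ⟪(tmul (kerFun H₂ z (1 : ℂ)) y : HilbertTensor H₂ _),
        tmul g (tmul h e')⟫_ℂ = ⟪mulOp hφ (kerFun _ z e),
          J.toContinuousLinearMap.adjoint (tmul g (tmul h e'))⟫_ℂ := by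
      intro g h
      rw [ContinuousLinearMap.adjoint_inner_right, ← hadj, LinearIsometry.coe_toContinuousLinearMap,
        hran, hJ, idTensor_tmul]
    have h3 := (h2 u₂ f).trans (h1 ▸ (h2 q u₁).symm)
    rw [HilbertTensor.inner_tmul, HilbertTensor.inner_tmul, kerFun_inner, kerFun_inner,
      hu₂ z, hq z] at h3
    rw [hp z]
    simpa using h3
  -- Testing `key` on `k₁(·, w)` puts the same factor `k₁(z, w)` on both sides; what remains on the
  -- right does not involve `w`.
  have hval : ∀ (w : Ω), scalarKernel H₁ z w ≠ 0 → ∀ e e' : E, ⟪φ w e, e'⟫_ℂ =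
      ⟪mulOp hφ₁ (tmul (kerFun H₁ z (1 : ℂ)) e), tmul u₁ e'⟫_ℂ := by
    intro w hw e e'
    have h1 := key e e' (kerFun H₁ w (1 : ℂ))
    rw [inner_kerTensor, mulOp_apply, tmul_apply, kerFun_one_apply, kerFun_one_apply, map_smul,
      inner_smul_left, scalarKernel_conj] at h1
    exact mul_left_cancel₀ hw h1
  ext e
  refine ext_inner_right ℂ fun e' => ?_
  rw [hval w hzw, hval z (scalarKernel_self_ne_zero hpoly₁ z)]

theorem isometry_mulOp_iff (hne : Ω.Nonempty) (hpoly₁ : ContainsPolys H₁)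
    (hpoly₂ : ContainsPolys H₂) (hdense : DensePolys H₁)
    (hchain : ∀ z w : Ω, KernelChain H₁ z w)
    {φ : Ω → E →L[ℂ] E} (hφ₁ : IsMultiplier (HilbertTensor H₁ E) φ)
    (hnorm : IsLUB (Set.range fun z => ‖φ z‖) ‖mulOp hφ₁‖)
    (hφ : IsMultiplier (HilbertTensor (ProductSpace (X := Ω) H₁ H₂) E) φ) :
    Isometry (mulOp hφ) ↔ ∃ V : E →L[ℂ] E, Isometry V ∧
      mulOp hφ = idTensor (ProductSpace (X := Ω) H₁ H₂) V := by
  refine ⟨fun hiso => ?_, fun ⟨V, hV, h⟩ => h ▸ isometry_idTensor hV⟩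
  have hk : ∀ z : Ω, scalarKernel (ProductSpace (X := Ω) H₁ H₂) z z ≠ 0 := fun z => by
    rw [scalarKernel_productSpace]
    exact mul_ne_zero (scalarKernel_self_ne_zero hpoly₁ z) (scalarKernel_self_ne_zero hpoly₂ z)
  -- The pointwise bound comes from the product space; the sup-norm formula carries it back to `H₁ ⊗
  -- E`.
  have hle : ‖mulOp hφ₁‖ ≤ 1 := by
    refine hnorm.2 ?_
    rintro _ ⟨z, rfl⟩
    refine (norm_le_norm_mulOp (mulOp hφ) (mulOp_apply hφ) (hk z)).trans ?_
    refine ContinuousLinearMap.opNorm_le_bound _ zero_le_one fun F => ?_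
    rw [(AddMonoidHomClass.isometry_iff_norm _).1 hiso F, one_mul]
  obtain ⟨z₀, hz₀⟩ := hne
  have hconst : ∀ z, φ z = φ ⟨z₀, hz₀⟩ := by
    intro z
    induction hchain ⟨z₀, hz₀⟩ z with
    | refl => rfl
    | tail _ h ih =>
      exact (eq_of_isometry_mulOp hpoly₁ hpoly₂ hdense hφ₁ hle hφ hiso h).trans ih
  have heq : mulOp hφ = idTensor (ProductSpace (X := Ω) H₁ H₂) (φ ⟨z₀, hz₀⟩) := by
    refine ContinuousLinearMap.ext fun F => RKHS.ext fun x => ?_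
    rw [mulOp_apply, idTensor_apply, hconst]
  refine ⟨_, (AddMonoidHomClass.isometry_iff_norm _).2 fun e => ?_, heq⟩
  have h1 := (AddMonoidHomClass.isometry_iff_norm _).1 hiso
    (tmul (kerFun (ProductSpace (X := Ω) H₁ H₂) ⟨z₀, hz₀⟩ (1 : ℂ)) e)
  rw [heq, idTensor_tmul, HilbertTensor.norm_tmul, HilbertTensor.norm_tmul] at h1
  refine mul_left_cancel₀ (norm_ne_zero_iff.2 fun h => hk ⟨z₀, hz₀⟩ ?_) h1
  rw [scalarKernel_eq_inner, h, inner_zero_left]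

end Constant

end RKHS

namespace RKHS

open HilbertTensor

/-! ### Holomorphic evaluations and operators commuting with coordinates -/

section Holomorphic

variable {n : ℕ} {Ω : Set (Fin n → ℂ)}

/-- In a space of holomorphic functions, point evaluation depends holomorphically on the point for
the operator norm. -/
theorem exists_differentiableOn_eval {H V : Type*} [NormedAddCommGroup V] [InnerProductSpace ℂ V]
    [CompleteSpace V] [NormedAddCommGroup H] [InnerProductSpace ℂ H] [CompleteSpace H]
    [RKHS ℂ H Ω V] (hΩ : IsOpen Ω) (hol : ∀ f : H, IsHolomorphic f) :
    ∃ ε : (Fin n → ℂ) → H →L[ℂ] V, DifferentiableOn ℂ ε Ω ∧ ∀ (z : Ω) f, ε z f = f z := by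
  classical
  let ε : (Fin n → ℂ) → H →L[ℂ] V := fun z =>
    if h : z ∈ Ω then (kerFun H ⟨z, h⟩).adjoint else 0
  have hε : ∀ (z : Ω) f, ε z f = f z := fun z f => by
    simp only [ε, dif_pos z.2, adjoint_kerFun]
  refine ⟨ε, DifferentiableOn.of_forall_clm_apply hΩ fun f => ?_, hε⟩
  obtain ⟨g, hg, hgf⟩ := hol f
  exact hg.congr fun z hz => by rw [hgf ⟨z, hz⟩, hε ⟨z, hz⟩]

variable {H₁ H₂ E : Type*}
  [NormedAddCommGroup H₁] [InnerProductSpace ℂ H₁] [CompleteSpace H₁] [RKHS ℂ H₁ Ω ℂ]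
  [NormedAddCommGroup H₂] [InnerProductSpace ℂ H₂] [CompleteSpace H₂] [RKHS ℂ H₂ Ω ℂ]
  [NormedAddCommGroup E] [InnerProductSpace ℂ E] [CompleteSpace E]

/-- Evaluation at `z` is the adjoint of `e ↦ k_z ⊗ e`. The Riesz map and the adjoint are both
conjugate-linear, so `Θ` is complex-linear and preserves holomorphy. -/
theorem exists_differentiableOn_eval_hilbertTensor (hΩ : IsOpen Ω)
    (hol : ∀ f : H₁, IsHolomorphic f) :
    ∃ ε : (Fin n → ℂ) → HilbertTensor H₁ E →L[ℂ] E, DifferentiableOn ℂ ε Ω ∧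
      ∀ (z : Ω) F, ε z F = F z := by
  obtain ⟨ε, hε, hεf⟩ := exists_differentiableOn_eval hΩ hol
  let Θ : (H₁ →L[ℂ] ℂ) →L[ℂ] HilbertTensor H₁ E →L[ℂ] E :=
    (ContinuousLinearMap.adjoint (𝕜 := ℂ) (E := E)
      (F := HilbertTensor H₁ E)).toLinearIsometry.toContinuousLinearMap.comp
      ((tmulL H₁ E).comp (InnerProductSpace.toDual ℂ H₁).symm.toLinearIsometry.toContinuousLinearMap)
  have hΘ : ∀ ℓ, Θ ℓ = (tmulL H₁ E ((InnerProductSpace.toDual ℂ H₁).symm ℓ)).adjoint := fun _ => rfl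
  refine ⟨fun z => Θ (ε z), Θ.differentiable.comp_differentiableOn hε, fun z F => ?_⟩
  have hz : (InnerProductSpace.toDual ℂ H₁).symm (ε z) = kerFun H₁ z (1 : ℂ) := by
    refine ext_inner_right ℂ fun f => ?_
    rw [InnerProductSpace.toDual_symm_apply, hεf, kerFun_inner]
    simp
  change Θ (ε z) F = F z
  rw [hΘ, hz]
  rfl

/-- `f z` is `J f` evaluated at `z` in each factor in turn; norm holomorphy of `ε₂` is needed
because its argument also varies with `z`. -/
theorem isHolomorphic_productSpace (hΩ : IsOpen Ω) (hol₁ : ∀ f : H₁, IsHolomorphic f)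
    (hol₂ : ∀ f : H₂, IsHolomorphic f) (f : ProductSpace (X := Ω) H₁ H₂) : IsHolomorphic f := by
  obtain ⟨ε₁, hε₁, hε₁f⟩ := exists_differentiableOn_eval_hilbertTensor (E := H₂) hΩ hol₁
  obtain ⟨ε₂, hε₂, hε₂f⟩ := exists_differentiableOn_eval hΩ hol₂
  obtain ⟨J, hJ⟩ := exists_isometry_productSpace (X := Ω) H₁ H₂
  refine ⟨fun z => ε₂ z (ε₁ z (J f)),
    hε₂.clm_apply (hε₁.clm_apply (differentiableOn_const _)), fun z => ?_⟩
  have h := J.inner_map_map f (kerFun _ z (1 : ℂ))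
  rw [hJ, inner_kerTensor, inner_kerFun, inner_kerFun] at h
  change ε₂ z (ε₁ z (J f)) = f z
  rw [hε₁f, hε₂f]
  exact (starRingEnd ℂ).injective (by simpa using h)

/-- The polynomial `p` is the diagonal restriction of `p ⊗ 1`. -/
theorem containsPolys_productSpace (hpoly₁ : ContainsPolys H₁) (hpoly₂ : ContainsPolys H₂) :
    ContainsPolys (ProductSpace (X := Ω) H₁ H₂) := by
  intro p
  obtain ⟨f, hf⟩ := hpoly₁ p
  obtain ⟨g, hg⟩ := hpoly₂ 1
  obtain ⟨J, hJ⟩ := exists_isometry_productSpace (X := Ω) H₁ H₂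
  refine ⟨J.toContinuousLinearMap.adjoint (tmul f g), fun z => ?_⟩
  have h : ⟪J.toContinuousLinearMap.adjoint (tmul f g), kerFun _ z (1 : ℂ)⟫_ℂ =
      ⟪(f z * g z), (1 : ℂ)⟫_ℂ := by
    rw [ContinuousLinearMap.adjoint_inner_left, LinearIsometry.coe_toContinuousLinearMap, hJ,
      HilbertTensor.inner_tmul, inner_kerFun, inner_kerFun]
    simp
  rw [inner_kerFun] at h
  have h' : (J.toContinuousLinearMap.adjoint (tmul f g)) z = f z * g z :=
    (starRingEnd ℂ).injective (by simpa using h)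
  rw [h', hf z, hg z]
  simp

/-- The coordinate functions of a module over polynomials are bounded by the multiplication
operators. -/
theorem norm_coord_le {H : Type*} [NormedAddCommGroup H] [InnerProductSpace ℂ H] [CompleteSpace H]
    [RKHS ℂ H Ω ℂ] (hmod : IsModule H) (hpoly : ContainsPolys H) (j : Fin n) (z : Ω) :
    ‖z.1 j‖ ≤ ‖mulOp (hmod j)‖ := by
  have hk : 0 < ‖kerFun H z (1 : ℂ)‖ := norm_pos_iff.2 fun h =>
    scalarKernel_self_ne_zero hpoly z (by rw [scalarKernel_eq_inner, h, inner_zero_left])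
  -- The kernel function at `z` is an eigenvector of the adjoint, with eigenvalue the conjugate of
  -- `z_j`.
  have h1 := (mulOp (hmod j)).adjoint.le_opNorm (kerFun H z (1 : ℂ))
  have h2 : (coordMul j z : ℂ →L[ℂ] ℂ).adjoint (1 : ℂ) = starRingEnd ℂ (z.1 j) := by
    refine ext_inner_right ℂ fun c => ?_
    rw [ContinuousLinearMap.adjoint_inner_left]
    simp [coordMul, mul_comm]
  rw [adjoint_mulOp_kerFun, h2, kerFun_eq_smul, norm_smul, RCLike.norm_conj,
    LinearIsometryEquiv.norm_map] at h1
  exact le_of_mul_le_mul_right h1 hk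

theorem isHolomorphic_coordMul (j : Fin n) :
    IsHolomorphic (coordMul j : Ω → E →L[ℂ] E) :=
  ⟨fun z => z j • ContinuousLinearMap.id ℂ E, by fun_prop, fun _ => rfl⟩

/-- A bounded operator commuting with the coordinate multiplications is a multiplication
operator. -/
theorem exists_isHolomorphic_of_commute {H : Type*} [NormedAddCommGroup H] [InnerProductSpace ℂ H]
    [CompleteSpace H] [RKHS ℂ H Ω ℂ] (hΩ : IsOpen Ω) (hol : ∀ f : H, IsHolomorphic f)
    (hpoly : ContainsPolys H) (hdense : DensePolys H) (hmod : IsModule (HilbertTensor H E))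
    (W : HilbertTensor H E →L[ℂ] HilbertTensor H E)
    (hW : ∀ j F, W (mulLin (hmod j) F) = mulLin (hmod j) (W F)) :
    ∃ φ : Ω → E →L[ℂ] E, IsHolomorphic φ ∧ ∀ F z, W F z = φ z (F z) := by
  obtain ⟨ε, hε, hεF⟩ := exists_differentiableOn_eval_hilbertTensor (E := E) hΩ hol
  obtain ⟨u, hu⟩ := hpoly 1
  have hu1 : ∀ z, u z = 1 := fun z => by rw [hu z, map_one]
  -- The symbol is read off from the constants: `φ(z) e = W (1 ⊗ e) (z)`.
  let φ : Ω → E →L[ℂ] E := fun z => ε z ∘L (W ∘L tmulL H E u)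
  have hφ : ∀ z e, φ z e = W (tmul u e) z := fun z e => hεF z _
  refine ⟨φ, ⟨fun z => ε z ∘L (W ∘L tmulL H E u), hε.clm_comp (differentiableOn_const _),
    fun _ => rfl⟩, fun F z => ?_⟩
  have hp : ∀ (p : MvPolynomial (Fin n) ℂ) (f : H), IsPoly f p → ∀ e,
      W (tmul f e) z = φ z (f z • e) := by
    intro p
    induction p using MvPolynomial.induction_on with
    | C a =>
      intro f hf e
      have : (tmul f e : HilbertTensor H E) = a • tmul u e :=
        RKHS.ext fun x => by
          rw [coe_smul, Pi.smul_apply, tmul_apply, tmul_apply, hf x, hu1, MvPolynomial.eval_C,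
            one_smul]
      rw [this, map_smul, coe_smul, Pi.smul_apply, ← hφ, hf z, MvPolynomial.eval_C, map_smul]
    | add p q ihp ihq =>
      intro f hf e
      obtain ⟨g, hg⟩ := hpoly p
      obtain ⟨h, hh⟩ := hpoly q
      have : f = g + h := RKHS.ext fun x => by
        rw [coe_add, Pi.add_apply, hf x, hg x, hh x, map_add]
      have h2 : (tmul f e : HilbertTensor H E) = tmul g e + tmul h e := by
        simp only [← tmulL_apply, this, map_add, add_apply]
      rw [h2, map_add, coe_add, Pi.add_apply, ihp g hg, ihq h hh, this, coe_add, Pi.add_apply,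
        add_smul, map_add]
    | mul_X p j ih =>
      intro f hf e
      obtain ⟨g, hg⟩ := hpoly p
      have hfg : ∀ x, f x = x.1 j * g x := fun x => by
        rw [hf x, hg x, map_mul, MvPolynomial.eval_X, mul_comm]
      have : (tmul f e : HilbertTensor H E) = mulLin (hmod j) (tmul g e) :=
        RKHS.ext fun x => by
          rw [mulLin_apply, tmul_apply, tmul_apply, hfg, coordMul, mul_smul]
          rfl
      rw [this, hW, mulLin_apply, ih g hg, hfg, mul_smul, map_smul, map_smul]
      simp [coordMul, smul_comm (g z)]
  have ht : ∀ f e, W (tmul f e) z = φ z (f z • e) := by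
    intro f e
    refine hdense.induction (P := fun f => W (tmul f e) z = φ z (f z • e)) ?_
      (isClosed_eq ?_ ?_) f
    · rintro f ⟨p, hf⟩
      exact hp p f hf e
    · exact (continuous_eval z).comp (W ∘L (tmulL H E).flip e).continuous
    · exact (φ z).continuous.comp ((continuous_eval z).smul continuous_const)
  have hclm : (ε z) ∘L W = (φ z) ∘L (ε z) := clm_ext fun f e => by
    rw [ContinuousLinearMap.comp_apply, ContinuousLinearMap.comp_apply, hεF, hεF, ht, tmul_apply]
  have := congrArg (fun A => A F) hclm
  simpa [hεF] using this

end Holomorphic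

/-! ### Unitary equivalence of submodules -/

section Submodules

variable {n : ℕ} {Ω : Set (Fin n → ℂ)} {H E : Type*}
  [NormedAddCommGroup H] [InnerProductSpace ℂ H] [CompleteSpace H] [RKHS ℂ H Ω ℂ]
  [NormedAddCommGroup E] [InnerProductSpace ℂ E] [CompleteSpace E]

/-- For `V` the isometry of `E` onto `E'`, the map `I ⊗ V` has range `S` and, acting as a constant
on values, commutes with the coordinates. -/
theorem unitarilyEquivalent_tensorSubspace (hK : IsModule (HilbertTensor H E))
    {S : Submodule ℂ (HilbertTensor H E)} (hS : IsModule S) {E' : Submodule ℂ E}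
    (W : E ≃ₗᵢ[ℂ] E') (hSE : S = tensorSubspace H E') : UnitarilyEquivalent hS hK := by
  let V : E →L[ℂ] E := E'.subtypeL ∘L W.toContinuousLinearEquiv.toContinuousLinearMap
  have hV : Isometry V := (isometry_subtype_coe (s := (E' : Set E))).comp W.isometry
  have hrange : V.range = E' := by
    ext e
    exact ⟨fun ⟨x, hx⟩ => hx ▸ (W x).2, fun he => ⟨W.symm ⟨e, he⟩, by simp [V]⟩⟩
  have hS' : S = (idTensor H V).range := by rw [range_idTensor hV, hrange, hSE]
  let T : HilbertTensor H E →ₗᵢ[ℂ] HilbertTensor H E :=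
    ⟨(idTensor H V).toLinearMap, (AddMonoidHomClass.isometry_iff_norm _).1 (isometry_idTensor hV)⟩
  let U : HilbertTensor H E ≃ₗᵢ[ℂ] S :=
    T.equivRange.trans (LinearIsometryEquiv.ofEq _ _ hS'.symm)
  have hU : ∀ F, (U F : HilbertTensor H E) = idTensor H V F := fun F => rfl
  refine ⟨U.symm, fun j f => U.injective ?_⟩
  rw [U.apply_symm_apply]
  obtain ⟨F, rfl⟩ := U.surjective f
  rw [U.symm_apply_apply]
  refine RKHS.ext fun x => ?_
  rw [mulLin_apply, coe_submodule, coe_submodule, hU, hU, idTensor_apply, idTensor_apply,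
    mulLin_apply]
  simp [coordMul]

theorem exists_commute_of_unitarilyEquivalent (hK : IsModule (HilbertTensor H E))
    {S : Submodule ℂ (HilbertTensor H E)} (hS : IsModule S) (h : UnitarilyEquivalent hS hK) :
    ∃ W : HilbertTensor H E →L[ℂ] HilbertTensor H E, Isometry W ∧ W.range = S ∧
      ∀ j F, W (mulLin (hK j) F) = mulLin (hK j) (W F) := by
  obtain ⟨U, hU⟩ := h
  refine ⟨S.subtypeL ∘L U.symm.toContinuousLinearEquiv.toContinuousLinearMap,
    (isometry_subtype_coe (s := (S : Set (HilbertTensor H E)))).comp U.symm.isometry, ?_, fun j F => ?_⟩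
  · ext F
    exact ⟨fun ⟨x, hx⟩ => hx ▸ (U.symm x).2, fun hF => ⟨U ⟨F, hF⟩, by simp⟩⟩
  · have h1 : U.symm (mulLin (hK j) F) = mulLin (hS j) (U.symm F) :=
      U.injective (by rw [hU, U.apply_symm_apply, U.apply_symm_apply])
    refine RKHS.ext fun x => ?_
    change ((U.symm (mulLin (hK j) F) : S) : HilbertTensor H E) x =
      mulLin (hK j) ((U.symm F : S) : HilbertTensor H E) x
    rw [h1, mulLin_apply, ← coe_submodule, mulLin_apply, coe_submodule]

end Submodules

end RKHS

/-! ### The main theorem -/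

theorem mainTheorem5 {n : ℕ} (Ω : Set (Fin n → ℂ)) (hΩ : IsOpen Ω) (hΩc : IsConnected Ω)
    (H₁ H₂ E : Type*)
    [NormedAddCommGroup H₁] [InnerProductSpace ℂ H₁] [CompleteSpace H₁] [RKHS ℂ H₁ Ω ℂ]
    [NormedAddCommGroup H₂] [InnerProductSpace ℂ H₂] [CompleteSpace H₂] [RKHS ℂ H₂ Ω ℂ]
    [NormedAddCommGroup E] [InnerProductSpace ℂ E] [CompleteSpace E]
    (hol₁ : ∀ f : H₁, RKHS.IsHolomorphic f) (hol₂ : ∀ f : H₂, RKHS.IsHolomorphic f)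
    (hmod : RKHS.IsModule H₁)
    (hpoly₁ : RKHS.ContainsPolys H₁) (hpoly₂ : RKHS.ContainsPolys H₂)
    (hdense : RKHS.DensePolys H₁)
    (hmul : ∀ φ : Ω → E →L[ℂ] E, RKHS.IsMultiplier (RKHS.HilbertTensor H₁ E) φ ↔
      RKHS.IsHolomorphic φ ∧ ∃ C : ℝ, ∀ z, ‖φ z‖ ≤ C)
    (hnorm : ∀ (φ : Ω → E →L[ℂ] E) (hφ : RKHS.IsMultiplier (RKHS.HilbertTensor H₁ E) φ),
      IsLUB (Set.range fun z => ‖φ z‖) ‖RKHS.mulOp hφ‖)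
    (hchain : ∀ z w : Ω, RKHS.KernelChain H₁ z w) :
    -- (i)
    (∀ φ : Ω → E →L[ℂ] E, RKHS.IsMultiplier (RKHS.HilbertTensor H₁ E) φ →
      ∃ hφ : RKHS.IsMultiplier (RKHS.HilbertTensor (RKHS.ProductSpace H₁ H₂) E) φ,
        Isometry (RKHS.mulOp hφ) ↔
          ∃ V : E →L[ℂ] E, Isometry V ∧
            RKHS.mulOp hφ = RKHS.HilbertTensor.idTensor (RKHS.ProductSpace H₁ H₂) V) ∧
    -- (ii)
    ∃ hK : RKHS.IsModule (RKHS.HilbertTensor (RKHS.ProductSpace H₁ H₂) E),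
      ∀ S : Submodule ℂ (RKHS.HilbertTensor (RKHS.ProductSpace H₁ H₂) E),
        IsClosed (S : Set (RKHS.HilbertTensor (RKHS.ProductSpace H₁ H₂) E)) →
        ∀ hS : RKHS.IsModule S,
          ((∃ E' : Submodule ℂ E, IsClosed (E' : Set E) ∧ Nonempty (E ≃ₗᵢ[ℂ] E') ∧
              S = RKHS.HilbertTensor.tensorSubspace (RKHS.ProductSpace H₁ H₂) E') →
            RKHS.UnitarilyEquivalent hS hK) ∧
          (RKHS.DensePolys (RKHS.ProductSpace H₁ H₂) →
            RKHS.UnitarilyEquivalent hS hK →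
            ∃ E' : Submodule ℂ E, IsClosed (E' : Set E) ∧ Nonempty (E ≃ₗᵢ[ℂ] E') ∧
              S = RKHS.HilbertTensor.tensorSubspace (RKHS.ProductSpace H₁ H₂) E') := by
  have hi : ∀ φ : Ω → E →L[ℂ] E, RKHS.IsMultiplier (RKHS.HilbertTensor H₁ E) φ →
      ∃ hφ : RKHS.IsMultiplier (RKHS.HilbertTensor (RKHS.ProductSpace H₁ H₂) E) φ,
        Isometry (RKHS.mulOp hφ) ↔
          ∃ V : E →L[ℂ] E, Isometry V ∧
            RKHS.mulOp hφ = RKHS.HilbertTensor.idTensor (RKHS.ProductSpace H₁ H₂) V :=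
    fun φ hφ => ⟨hφ.productSpace, RKHS.isometry_mulOp_iff hΩc.nonempty hpoly₁ hpoly₂ hdense hchain
      hφ (hnorm φ hφ) _⟩
  have hK : RKHS.IsModule (RKHS.HilbertTensor (RKHS.ProductSpace H₁ H₂) E) := by
    intro j
    -- Coordinates are bounded on `Ω` because `H₁` is a module, hence are multipliers of `H₁ ⊗ E`.
    refine RKHS.IsMultiplier.productSpace ((hmul _).2
      ⟨RKHS.isHolomorphic_coordMul j, ‖RKHS.mulOp (hmod j)‖, fun z => ?_⟩)
    refine ContinuousLinearMap.opNorm_le_bound _ (norm_nonneg _) fun e => ?_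
    refine (norm_smul _ _).trans_le ?_
    exact mul_le_mul_of_nonneg_right (RKHS.norm_coord_le hmod hpoly₁ j z) (norm_nonneg e)
  refine ⟨hi, hK, fun S _ hS => ⟨?_, fun hdenseK hequiv => ?_⟩⟩
  · rintro ⟨E', _, ⟨W⟩, hSE⟩
    exact RKHS.unitarilyEquivalent_tensorSubspace hK hS W hSE
  · obtain ⟨W, hWiso, hWS, hWcomm⟩ := RKHS.exists_commute_of_unitarilyEquivalent hK hS hequiv
    have hpolyK := RKHS.containsPolys_productSpace hpoly₁ hpoly₂
    obtain ⟨φ, hφhol, hφ⟩ := RKHS.exists_isHolomorphic_of_commute hΩ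
      (RKHS.isHolomorphic_productSpace hΩ hol₁ hol₂) hpolyK hdenseK hK W hWcomm
    -- Part (i) concerns multipliers of `H₁ ⊗ E`; the bound `‖W‖` on `φ` and `hmul` make `φ` one of
    -- these.
    have hφ₁ : RKHS.IsMultiplier (RKHS.HilbertTensor H₁ E) φ := (hmul φ).2 ⟨hφhol, ‖W‖, fun z =>
      RKHS.norm_le_norm_mulOp W hφ (RKHS.scalarKernel_self_ne_zero hpolyK z)⟩
    obtain ⟨hφK, hiff⟩ := hi φ hφ₁
    have hWφ : RKHS.mulOp hφK = W :=
      ContinuousLinearMap.ext fun F => RKHS.ext fun x => by rw [RKHS.mulOp_apply, hφ]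
    rw [hWφ] at hiff
    obtain ⟨V, hV, hWV⟩ := hiff.1 hWiso
    refine ⟨V.range, hV.isClosedEmbedding.isClosed_range, ⟨LinearIsometry.equivRange
      ⟨V.toLinearMap, (AddMonoidHomClass.isometry_iff_norm V).1 hV⟩⟩, ?_⟩
    rw [← RKHS.HilbertTensor.range_idTensor hV, ← hWV, hWS]
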